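/- Let $\mathcal{X}\subseteq\mathbb{R}^n$, $\mathcal{Y}\subseteq\mathbb{R}$, $\mathcal{Z}\subseteq\mathbb{R}^d$, and let $\mathcal{E}_{tr}$ be a finite nonempty set of environments; in environment $e$ the feature $X^e\in\mathcal{X}$ and the label $Y^e\in\mathcal{Y}$ have an arbitrary joint probability distribution. Let $\ell$ be a measurable loss and define the risk of a predictor $f:\mathcal{X}\to\mathbb{R}$ in environment $e$ by $R^e(f)=\mathbb{E}[\ell(f(X^e),Y^e)]$. Let $\mathcal{H}_\Phi$ be any class of measurable representations $\Phi:\mathcal{X}\to\mathcal{Z}$. Let $\mathcal{H}_w\subseteq\mathbb{R}^d$ be a closed, bounded and convex set of weight vectors with nonempty interior, where $\mathbf{w}\in\mathbb{R}^d$ is identified with the linear classifier $w(z)=\mathbf{w}^{t}z$ on $\mathcal{Z}$. Suppose that for all $z\in\mathcal{Z}$ and $y\in\mathcal{Y}$ the loss $\ell(\mathbf{w}^{t}z,y)$ is convex and continuous in $\mathbf{w}\in\mathbb{R}^d$, and that $\ell(\mathbf{w}^{t}\Phi(X^e),Y^e)$ is integrable for all $\mathbf{w}\in\mathcal{H}_w$,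 $\Phi\in\mathcal{H}_\Phi$, $e\in\mathcal{E}_{tr}$. In the EIRM game a representation $\Phi\in\mathcal{H}_\Phi$ is selected and observed by all environments, each environment $e$ then chooses a classifier $w^e\in\mathcal{H}_w$, and its utility is $-R^e(w^{av}\circ\Phi)$ with $w^{av}=\frac{1}{|\mathcal{E}_{tr}|}\sum_{q\in\mathcal{E}_{tr}}w^q$. A tuple $(\Phi,\{w^q\}_{q\in\mathcal{E}_{tr}})$ is a pure-strategy Nash equilibrium if no environment can increase its utility by changing only its own classifier within $\mathcal{H}_w$. Then: 1. For every $\Phi\in\mathcal{H}_\Phi$ there is a pure-strategy Nash equilibrium $(\Phi,\{w^q\}_{q\in\mathcal{E}_{tr}})$ of the EIRM game. 2. If $(\Phi,\{w^q\}_{q\in\mathcal{E}_{tr}})$ is a pure-strategy Nash equilibrium all of whose weight vectors $\mathbf{w}^q$ lie in the interior of $\mathcal{H}_w$, then the ensemble predictor $w^{av}\circ\Phi$ is an invariant predictor among all linear models: for every environment $e\in\mathcal{E}_{tr}$ and every linear classifier $\bar w(z)=\bar{\mathbf{w}}^{t}z$ with $\bar{\mathbf{w}}\in\mathbb{R}^d$,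 $R^e(w^{av}\circ\Phi)\le R^e(\bar w\circ\Phi)$, where the risk on the right may be $+\infty$. -/

import Mathlib

open MeasureTheory

namespace EIRM

/-- Expectation of a real random variable, with values in `[-∞, ∞]`: the integral of the positive
part minus the integral of the negative part. It is `⊥` if both integrals are infinite. -/
noncomputable def expect {Ω : Type*} [MeasurableSpace Ω] (μ : Measure Ω) (g : Ω → ℝ) : EReal :=
  ((∫⁻ p, ENNReal.ofReal (g p) ∂μ : ENNReal) : EReal)
    - ((∫⁻ p, ENNReal.ofReal (-g p) ∂μ : ENNReal) : EReal)

/-- For an integrable random variable the extended expectation is the usual integral. -/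
theorem expect_eq_integral {Ω : Type*} [MeasurableSpace Ω] {μ : Measure Ω} {g : Ω → ℝ}
    (hg : Integrable g μ) : expect μ g = ((∫ p, g p ∂μ : ℝ) : EReal) := by
  have h1 : (∫⁻ p, ENNReal.ofReal (g p) ∂μ) ≠ ⊤ := hg.lintegral_lt_top.ne
  have h2 : (∫⁻ p, ENNReal.ofReal (-g p) ∂μ) ≠ ⊤ := hg.neg.lintegral_lt_top.ne
  rw [expect, integral_eq_lintegral_pos_part_sub_lintegral_neg_part hg, EReal.coe_sub,
    EReal.coe_ennreal_toReal h1, EReal.coe_ennreal_toReal h2]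

/-- `s` is a Nash equilibrium in pure strategies of the game with players `ι`, strategy sets `S i`
and utilities `u i`: no player gains by a unilateral deviation. -/
def IsPureNash {ι A V : Type*} [DecidableEq ι] [LE V]
    (S : ι → Set A) (u : ι → (ι → A) → V) (s : ι → A) : Prop :=
  (∀ i, s i ∈ S i) ∧ ∀ i, ∀ k ∈ S i, u i (Function.update s i k) ≤ u i s

section Model

variable {E X Y Z : Type*} [MeasurableSpace X] [MeasurableSpace Y]

/-- The risk `R^e(f)`: the expected loss of the predictor `f` in the environment `e`, in which
feature and label have the joint law `P e`. -/
noncomputable def risk (P : E → Measure (X × Y)) (loss : ℝ → Y → ℝ) (e : E) (f : X → ℝ) : EReal :=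
  expect (P e) (fun p => loss (f p.1) p.2)

/-- The ensemble classifier: the pointwise average of the classifiers of all environments. -/
noncomputable def ensemble [Fintype E] (w : E → Z → ℝ) : Z → ℝ :=
  fun z => (1 / (Fintype.card E : ℝ)) * ∑ q, w q z

/-- The utility of the environment `e` when the environments play the classifiers `w`. -/
noncomputable def utility [Fintype E] (P : E → Measure (X × Y)) (loss : ℝ → Y → ℝ) (Φ : X → Z)
    (e : E) (w : E → Z → ℝ) : EReal :=
  -risk P loss e (ensemble w ∘ Φ)

/-- The pure Nash equilibria `(Φ, w)` of the EIRM game with representation class `HΦ` and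
classifier class `H`: a representation is selected from `HΦ` and observed by all environments,
and then each environment chooses a classifier from `H`. -/
def pureNE [Fintype E] [DecidableEq E] (P : E → Measure (X × Y)) (loss : ℝ → Y → ℝ)
    (HΦ : Set (X → Z)) (H : Set (Z → ℝ)) : Set ((X → Z) × (E → Z → ℝ)) :=
  {s | s.1 ∈ HΦ ∧ IsPureNash (fun _ : E => H) (utility P loss s.1) s.2}

/-- The pairs `(Φ, w)` such that `Φ` elicits the invariant predictor `w ∘ Φ`: the classifier `w`
attains the minimum risk over the class `H` on top of `Φ`, simultaneously in all environments. -/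
def invariantPairs (P : E → Measure (X × Y)) (loss : ℝ → Y → ℝ)
    (HΦ : Set (X → Z)) (H : Set (Z → ℝ)) : Set ((X → Z) × (Z → ℝ)) :=
  {s | s.1 ∈ HΦ ∧ s.2 ∈ H ∧
    ∀ e, ∀ w' ∈ H, risk P loss e (s.2 ∘ s.1) ≤ risk P loss e (w' ∘ s.1)}

end Model

/-- The linear classifier `z ↦ wᵀ z` on `Z ⊆ ℝᵈ` with weight vector `w`. -/
noncomputable def linearClassifier {d : ℕ} (Z : Set (EuclideanSpace ℝ (Fin d)))
    (w : EuclideanSpace ℝ (Fin d)) : Z → ℝ :=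
  fun z => inner ℝ w (z : EuclideanSpace ℝ (Fin d))

end EIRM

/-! An environment's deviation only translates the average weight, and each risk is a convex
function of that average, so both claims concern convex functions of `meanWeight w`.

Existence: on `Hw` the risks are finite, convex and lower semicontinuous (Fatou, with the integrable
minorant of `exists_integrable_le`), but continuity is only available in the interior. With `F w`
the sum of the costs at `w` and `G w v` the sum of the costs of the unilateral deviations towards
`v`, one has `G w w = F w`. Without an equilibrium every `{v | G w v < F w}` is nonempty, and
convexity lets `v` be moved into the interior, where `G` is continuous in `w`. Fan–Browder then
gives `G w w < F w`, a contradiction (`exists_nash_meanWeight`). Fan–Browder follows from a smooth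
selection and Brouwer's theorem for smooth maps, and the latter from the absence of a C¹ retraction
onto the sphere.

Invariance: from interior weights each environment can push the average a little towards any `u`.
Equilibrium says that this does not lower its risk, and convexity of the loss extends the comparison
to `u` itself, even at infinite risk (`expect_le_of_integral_le_segment`). -/

section NoRetraction

/-! ### No C¹ retraction onto the sphere, and Brouwer's theorem for smooth maps. -/

open Metric Set Filter Topology Polynomial

theorem Matrix.exists_polynomial_eval_eq_det_one_add_smul {ι : Type*} [Fintype ι] [DecidableEq ι]
    (M : Matrix ι ι ℝ) :
    ∃ p : ℝ[X], p.natDegree ≤ Fintype.card ι ∧ ∀ t, p.eval t = (1 + t • M).det := by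
  refine ⟨_, natDegree_det_X_add_C_le M 1, fun t => ?_⟩
  rw [← coe_evalRingHom, RingHom.map_det]
  congr 1
  ext i j
  by_cases h : i = j <;> simp [h, add_comm, mul_comm (M _ _)]

variable {V : Type*} [NormedAddCommGroup V]

/-- Lagrange interpolation of the polynomial `t ↦ det (1 + t A)` at `t = 1`. -/
theorem exists_det_one_add_eq_sum_det_one_add_smul [NormedSpace ℝ V] [FiniteDimensional ℝ V]
    (s : Finset ℝ) (hs : Module.finrank ℝ V < s.card) :
    ∃ c : ℝ → ℝ, ∑ t ∈ s, c t = 1 ∧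
      ∀ A : V →L[ℝ] V, (1 + A).det = ∑ t ∈ s, c t * (1 + t • A).det := by
  have hinj : Set.InjOn (id : ℝ → ℝ) s := Function.injective_id.injOn
  have hne : s.Nonempty := Finset.card_pos.1 (by omega)
  refine ⟨fun t => (Lagrange.basis s id t).eval 1, ?_, fun A => ?_⟩
  · rw [← eval_finsetSum, Lagrange.sum_basis hinj hne, eval_one]
  · let b := Module.finBasis ℝ V
    obtain ⟨p, hp, hpe⟩ :=
      (LinearMap.toMatrix b b (A : V →ₗ[ℝ] V)).exists_polynomial_eval_eq_det_one_add_smul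
    have hdet : ∀ t : ℝ, (1 + t • A).det = p.eval t := by
      intro t
      rw [hpe, ContinuousLinearMap.det, ← LinearMap.det_toMatrix b]
      congr 1
      simp [LinearMap.toMatrix_one]
    have h1 : (1 + A).det = p.eval 1 := by simpa using hdet 1
    have hdeg : p.degree < s.card := by
      refine lt_of_le_of_lt degree_le_natDegree ?_
      rw [Fintype.card_fin] at hp
      exact_mod_cast lt_of_le_of_lt hp hs
    rw [h1, Lagrange.eq_interpolate hinj hdeg, Lagrange.interpolate_apply, eval_finsetSum]
    refine Finset.sum_congr rfl fun t _ => ?_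
    rw [eval_mul, eval_C, hdet, mul_comm]
    rfl

theorem LinearMap.range_eq_top_of_det_ne_zero [NormedSpace ℝ V] [FiniteDimensional ℝ V]
    {f : V →ₗ[ℝ] V} (hf : LinearMap.det f ≠ 0) : LinearMap.range f = ⊤ :=
  (LinearMap.isUnit_iff_range_eq_top _).1
    ((LinearMap.isUnit_iff_isUnit_det _).2 (isUnit_iff_ne_zero.2 hf))

/-- A kernel vector of `1 + s • A` would satisfy `v = -s • A v`, impossible when `s * ‖A‖ < 1`. So
the determinant has no zero on `[0, t]` and keeps the sign of its value `1` at `s = 0`. -/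
theorem ContinuousLinearMap.det_one_add_smul_pos [NormedSpace ℝ V] [FiniteDimensional ℝ V]
    (A : V →L[ℝ] V) {t : ℝ} (ht : 0 ≤ t) (h : t * ‖A‖ < 1) : 0 < (1 + t • A).det := by
  have hcont : Continuous fun s : ℝ => (1 + s • A).det :=
    ContinuousLinearMap.continuous_det.comp (by fun_prop)
  have hne : ∀ s ∈ Icc 0 t, (1 + s • A).det ≠ 0 := by
    intro s hs h0
    have hker := LinearMap.bot_lt_ker_of_det_eq_zero h0
    obtain ⟨v, hv, hv0⟩ := (Submodule.ne_bot_iff _).1 hker.ne'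
    have hv' : v = -(s • A v) := by
      have : v + s • A v = 0 := by simpa using hv
      exact eq_neg_of_add_eq_zero_left this
    have hpos : 0 < ‖v‖ := norm_pos_iff.2 hv0
    have : ‖v‖ ≤ t * ‖A‖ * ‖v‖ := by
      calc ‖v‖ = s * ‖A v‖ := by
            conv_lhs => rw [hv']
            rw [norm_neg, norm_smul, Real.norm_of_nonneg hs.1]
        _ ≤ t * (‖A‖ * ‖v‖) := by
            gcongr
            · exact hs.2
            · exact A.le_opNorm v
        _ = _ := by ring
    nlinarith
  by_contra hcon
  have hmem : (0 : ℝ) ∈ (fun s : ℝ => (1 + s • A).det) '' Icc 0 t :=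
    intermediate_value_Icc' ht hcont.continuousOn
      ⟨not_lt.1 hcon, by simp [ContinuousLinearMap.det]⟩
  obtain ⟨s, hs, h0⟩ := hmem
  exact hne s hs h0


/-- A perturbation of the identity with Lipschitz constant less than `1` is injective. -/
theorem injOn_add_smul_of_lipschitzOnWith [NormedSpace ℝ V] {h : V → V} {s : Set V} {C : NNReal}
    (hL : LipschitzOnWith C h s) {t : ℝ} (ht : 0 ≤ t) (htC : t * C < 1) :
    InjOn (fun x => x + t • h x) s := by
  intro x hx y hy hxy
  by_contra hne
  have hpos : 0 < ‖x - y‖ := norm_pos_iff.2 (sub_ne_zero.2 hne)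
  have h1 : x - y = t • (h y - h x) := by
    have : x + t • h x = y + t • h y := hxy
    rw [smul_sub, sub_eq_sub_iff_add_eq_add, this]
    abel
  have h2 : ‖h y - h x‖ ≤ C * ‖x - y‖ := by
    have := hL.dist_le_mul y hy x hx
    rwa [dist_eq_norm, dist_eq_norm, norm_sub_rev y x] at this
  have h3 : ‖x - y‖ = t * ‖h y - h x‖ := by
    conv_lhs => rw [h1]
    rw [norm_smul, Real.norm_of_nonneg ht]
  nlinarith [mul_le_mul_of_nonneg_left h2 ht]

variable [InnerProductSpace ℝ V] [FiniteDimensional ℝ V]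

/-- The image is open by the inverse function theorem. It is also relatively closed in the ball:
limit points come from the closed ball, and the map fixes the sphere, so a limit point inside the
ball has its preimage inside. Connectedness of the ball finishes. -/
theorem image_ball_add_smul_eq_ball {r : V → V} (hr : ContDiff ℝ 1 r)
    (hnorm : ∀ x, ‖r x‖ = 1) (hid : ∀ x, ‖x‖ = 1 → r x = x) {t : ℝ} (ht0 : 0 ≤ t) (ht1 : t < 1)
    (hdet : ∀ x ∈ ball (0 : V) 1, (1 + t • fderiv ℝ (fun x => r x - x) x).det ≠ 0) :
    (fun x => x + t • (r x - x)) '' ball (0 : V) 1 = ball 0 1 := by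
  set f : V → V := fun x => x + t • (r x - x) with hf
  have hh : ContDiff ℝ 1 (fun x => r x - x) := hr.sub contDiff_id
  have hfc : ContDiff ℝ 1 f := contDiff_id.add (hh.const_smul t)
  have hfd : ∀ x, HasStrictFDerivAt f (1 + t • fderiv ℝ (fun x => r x - x) x) x := by
    intro x
    exact (hasStrictFDerivAt_id x).add
      ((hh.contDiffAt.hasStrictFDerivAt one_ne_zero).const_smul t)
  have hsub : f '' ball 0 1 ⊆ ball 0 1 := by
    rintro _ ⟨x, hx, rfl⟩
    rw [mem_ball_zero_iff] at hx ⊢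
    have : f x = (1 - t) • x + t • r x := by simp only [hf]; module
    rw [this]
    calc ‖(1 - t) • x + t • r x‖ ≤ ‖(1 - t) • x‖ + ‖t • r x‖ := norm_add_le _ _
      _ = (1 - t) * ‖x‖ + t := by
          rw [norm_smul, norm_smul, hnorm, Real.norm_of_nonneg ht0,
            Real.norm_of_nonneg (by linarith)]
          ring
      _ < 1 := by nlinarith
  refine hsub.antisymm ?_
  have hopen : IsOpen (f '' ball 0 1) := by
    rw [isOpen_iff_mem_nhds]
    rintro _ ⟨x, hx, rfl⟩
    have hsurj : (1 + t • fderiv ℝ (fun x => r x - x) x : V →L[ℝ] V).range = ⊤ := 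
      LinearMap.range_eq_top_of_det_ne_zero (hdet x hx)
    rw [← (hfd x).map_nhds_eq_of_surj hsurj]
    exact image_mem_map (isOpen_ball.mem_nhds hx)
  refine (convex_ball (0 : V) 1).isPreconnected.subset_of_closure_inter_subset hopen ?_ ?_
  · refine ⟨f 0, hsub ⟨0, by simp, rfl⟩, 0, by simp, rfl⟩
  · rintro y ⟨hy, hyb⟩
    have hcl : closure (f '' ball 0 1) ⊆ f '' closedBall 0 1 :=
      closure_minimal (image_mono ball_subset_closedBall)
        ((isCompact_closedBall _ _).image hfc.continuous).isClosed
    obtain ⟨x, hx, rfl⟩ := hcl hy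
    rw [mem_closedBall_zero_iff] at hx
    rcases hx.lt_or_eq with h | h
    · exact ⟨x, by simpa using h, rfl⟩
    · have : f x = x := by simp [hf, hid x h]
      rw [this, mem_ball_zero_iff] at hyb
      exact absurd h hyb.ne

/-- There is no continuously differentiable retraction onto the unit sphere. -/
theorem not_exists_contDiff_retraction_sphere :
    ¬ ∃ r : V → V, ContDiff ℝ 1 r ∧ (∀ x, ‖r x‖ = 1) ∧ ∀ x, ‖x‖ = 1 → r x = x := by
  rintro ⟨r, hr, hnorm, hid⟩
  let _ : MeasurableSpace V := borel V
  have : BorelSpace V := ⟨rfl⟩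
  set h : V → V := fun x => r x - x with hh_def
  have hh : ContDiff ℝ 1 h := hr.sub contDiff_id
  have hdiff : Differentiable ℝ h := hh.differentiable one_ne_zero
  have hcf : Continuous (fderiv ℝ h) := hh.continuous_fderiv one_ne_zero
  obtain ⟨C₀, hC₀⟩ := (isCompact_closedBall (0 : V) 1).exists_bound_of_continuousOn
    hcf.continuousOn
  -- The summand `1` ensures `1 ≤ C`, so that `t * C < 1` also forces `t < 1`.
  set C : NNReal := C₀.toNNReal + 1 with hC_def
  have hC1 : (1 : ℝ) ≤ C := by simp [hC_def]
  have hC : ∀ x ∈ ball (0 : V) 1, ‖fderiv ℝ h x‖ ≤ C := by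
    intro x hx
    refine (hC₀ x (ball_subset_closedBall hx)).trans ?_
    have := Real.le_coe_toNNReal C₀
    rw [hC_def]; push_cast
    linarith
  have hL : LipschitzOnWith C h (ball 0 1) :=
    (convex_ball (0 : V) 1).lipschitzOnWith_of_nnnorm_fderiv_le (fun x _ => hdiff x) hC
  obtain ⟨s, hsI, hscard⟩ : ∃ s : Finset ℝ, ↑s ⊆ Ioo (0 : ℝ) (1 / C) ∧
      s.card = Module.finrank ℝ V + 1 :=
    (Ioo_infinite (by positivity)).exists_subset_card_eq _
  obtain ⟨c, hc1, hc⟩ := exists_det_one_add_eq_sum_det_one_add_smul (V := V) s (by omega)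
  -- For small `t` the map `x + t • h x` is a bijection of the ball with positive Jacobian, so the
  -- integral of the Jacobian is the volume. Interpolation carries this constant to `t = 1`, where
  -- the map is `r`.
  have hvol : ∀ t ∈ s, ∫ x in ball (0 : V) 1, (1 + t • fderiv ℝ h x).det
      = volume.real (ball (0 : V) 1) := by
    intro t hts
    obtain ⟨ht0, htC⟩ := hsI hts
    have htC' : t * C < 1 := by rwa [lt_div_iff₀ (by positivity)] at htC
    have ht1 : t < 1 := by nlinarith
    have hpos : ∀ x ∈ ball (0 : V) 1, 0 < (1 + t • fderiv ℝ h x).det := fun x hx =>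
      ContinuousLinearMap.det_one_add_smul_pos _ ht0.le
        ((mul_le_mul_of_nonneg_left (hC x hx) ht0.le).trans_lt htC')
    have key := lintegral_abs_det_fderiv_eq_addHaar_image volume
      (f := fun x => x + t • h x) (f' := fun x => 1 + t • fderiv ℝ h x) (measurableSet_ball)
      (fun x _ => ((hasFDerivAt_id x).add
        ((hdiff x).hasFDerivAt.const_smul t)).hasFDerivWithinAt)
      (injOn_add_smul_of_lipschitzOnWith hL ht0.le htC')
    rw [image_ball_add_smul_eq_ball hr hnorm hid ht0.le ht1 (fun x hx => (hpos x hx).ne')] at key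
    rw [Measure.real, ← key, integral_eq_lintegral_of_nonneg_ae]
    · congr 1
      refine setLIntegral_congr_fun measurableSet_ball fun x hx => ?_
      simp only [abs_of_pos (hpos x hx)]
    · exact (ae_restrict_iff' measurableSet_ball).2 (ae_of_all _ fun x hx => (hpos x hx).le)
    · exact (ContinuousLinearMap.continuous_det.comp (by fun_prop)).aestronglyMeasurable
  -- The derivative of `r` cannot be onto: differentiating `‖r‖ ^ 2 = 1` along a `v` that it sends
  -- to `r x` gives `2 = 0`.
  have hzero : ∀ x, (1 + fderiv ℝ h x).det = 0 := by
    intro x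
    have hrd : HasFDerivAt r (1 + fderiv ℝ h x) x := by
      have := (hasFDerivAt_id x).add (hdiff x).hasFDerivAt
      refine this.congr_of_eventuallyEq (Eventually.of_forall fun y => ?_)
      simp [hh_def]
    by_contra hd
    have hsurj : Function.Surjective (1 + fderiv ℝ h x : V →L[ℝ] V) := 
      LinearMap.range_eq_top.1 (LinearMap.range_eq_top_of_det_ne_zero hd)
    obtain ⟨v, hv⟩ := hsurj (r x)
    have h1 := (hrd.inner ℝ hrd)
    have h2 : (fun y => inner ℝ (r y) (r y)) = fun _ : V => (1 : ℝ) := by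
      funext y
      rw [real_inner_self_eq_norm_sq, hnorm, one_pow]
    rw [h2] at h1
    have h3 := h1.unique (hasFDerivAt_const (1 : ℝ) x)
    have h4 := congrArg (fun L : V →L[ℝ] ℝ => L v) h3
    simp only [ContinuousLinearMap.comp_apply, ContinuousLinearMap.prod_apply,
      fderivInnerCLM_apply, hv, zero_apply, real_inner_self_eq_norm_sq,
      hnorm] at h4
    norm_num at h4
  have hint : ∀ t ∈ s, IntegrableOn (fun x => c t * (1 + t • fderiv ℝ h x).det)
      (ball (0 : V) 1) := by
    intro t _
    have hcont : Continuous fun x => c t * (1 + t • fderiv ℝ h x).det :=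
      continuous_const.mul (ContinuousLinearMap.continuous_det.comp (by fun_prop))
    exact (hcont.continuousOn.integrableOn_compact (isCompact_closedBall 0 1)).mono_set
      ball_subset_closedBall
  have hcontra : volume.real (ball (0 : V) 1) = 0 := by
    calc volume.real (ball (0 : V) 1) = ∑ t ∈ s, c t * volume.real (ball (0 : V) 1) := by
          rw [← Finset.sum_mul, hc1, one_mul]
      _ = ∑ t ∈ s, ∫ x in ball (0 : V) 1, c t * (1 + t • fderiv ℝ h x).det := by
          refine Finset.sum_congr rfl fun t ht => ?_
          rw [integral_const_mul, hvol t ht]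
      _ = ∫ x in ball (0 : V) 1, (1 + fderiv ℝ h x).det := by
          rw [← integral_finsetSum _ hint]
          simp only [← hc]
      _ = 0 := by simp [hzero]
  exact (ENNReal.toReal_pos (measure_ball_pos volume (0 : V) one_pos).ne'
    measure_ball_lt_top.ne).ne' hcontra

/-- **Brouwer's fixed point theorem** for smooth maps into the open unit ball. -/
theorem exists_fixedPoint_of_contDiff_of_norm_lt_one {g : V → V} (hg : ContDiff ℝ 1 g)
    (hg1 : ∀ x, ‖g x‖ < 1) : ∃ x, g x = x := by
  by_contra! hne
  set a : V → ℝ := fun x => ‖x - g x‖ ^ 2 with ha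
  set b : V → ℝ := fun x => inner ℝ (g x) (x - g x) with hb
  set c : V → ℝ := fun x => 1 - ‖g x‖ ^ 2 with hc
  have hapos : ∀ x, 0 < a x := fun x => by
    have := norm_pos_iff.2 (sub_ne_zero.2 (hne x).symm)
    positivity
  have hcpos : ∀ x, 0 < c x := fun x => by
    have := hg1 x
    have := norm_nonneg (g x)
    simp only [hc]
    nlinarith
  have hdpos : ∀ x, 0 < b x ^ 2 + a x * c x := fun x => by
    have := mul_pos (hapos x) (hcpos x)
    positivity
  -- The positive root of `a τ² + 2 b τ - c`: the ray from `g x` through `x` meets the unit sphere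
  -- at parameter `σ x`. Since `c > 0` everywhere, the radicand never vanishes and `σ` is C¹ on all
  -- of `V`.
  set σ : V → ℝ := fun x => (√(b x ^ 2 + a x * c x) - b x) / a x with hσ
  have hσeq : ∀ x, a x * σ x ^ 2 + 2 * b x * σ x = c x := fun x => by
    have h1 := Real.sq_sqrt (hdpos x).le
    have h2 : a x * σ x = √(b x ^ 2 + a x * c x) - b x := mul_div_cancel₀ _ (hapos x).ne'
    have h3 : a x * (a x * σ x ^ 2 + 2 * b x * σ x - c x) = 0 := by
      linear_combination (a x * σ x + √(b x ^ 2 + a x * c x) - b x + 2 * b x) * h2 + h1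
    have := (mul_eq_zero.1 h3).resolve_left (hapos x).ne'
    linarith
  have hσpos : ∀ x, 0 < σ x := fun x => by
    refine div_pos (sub_pos.2 ?_) (hapos x)
    refine lt_of_le_of_lt (le_abs_self _) ?_
    rw [← Real.sqrt_sq_eq_abs]
    exact Real.sqrt_lt_sqrt (sq_nonneg _) (by linarith [mul_pos (hapos x) (hcpos x)])
  have hnormsq : ∀ x (τ : ℝ), ‖g x + τ • (x - g x)‖ ^ 2
      = 1 + (a x * τ ^ 2 + 2 * b x * τ - c x) := fun x τ => by
    rw [norm_add_sq_real, norm_smul, mul_pow, inner_smul_right, Real.norm_eq_abs, sq_abs]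
    simp only [ha, hb, hc]
    ring
  apply not_exists_contDiff_retraction_sphere (V := V)
  refine ⟨fun x => g x + σ x • (x - g x), ?_, fun x => ?_, fun x hx => ?_⟩
  · have hsub : ContDiff ℝ 1 fun x => x - g x := contDiff_id.sub hg
    have hac : ContDiff ℝ 1 a := hsub.norm_sq ℝ
    have hbc : ContDiff ℝ 1 b := hg.inner ℝ hsub
    have hcc : ContDiff ℝ 1 c := contDiff_const.sub (hg.norm_sq ℝ)
    have hσc : ContDiff ℝ 1 σ :=
      ((((hbc.pow 2).add (hac.mul hcc)).sqrt fun x => (hdpos x).ne').sub hbc).div hac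
        fun x => (hapos x).ne'
    exact hg.add (hσc.smul hsub)
  · have := hnormsq x (σ x)
    rw [hσeq, sub_self, add_zero] at this
    exact (pow_eq_one_iff_of_nonneg (norm_nonneg _) two_ne_zero).1 this
  · have h1 := hnormsq x 1
    rw [one_smul, add_sub_cancel, hx] at h1
    have h2 := hσeq x
    -- On the sphere `1` is a root, so the other root is `-c / a`, which is negative.
    have h3 : (σ x - 1) * (a x * σ x + c x) = 0 := by
      linear_combination σ x * h1 + h2
    have h4 : σ x = 1 := by
      have := (mul_eq_zero.1 h3).resolve_right
        (add_pos (mul_pos (hapos x) (hσpos x)) (hcpos x)).ne'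
      linarith
    simp [h4]

end NoRetraction

/-! ### From Brouwer to the Fan–Browder theorem. -/

section FanBrowder

open Metric Set Filter Topology
open scoped Manifold ContDiff

variable {W : Type*} [NormedAddCommGroup W] [NormedSpace ℝ W] [FiniteDimensional ℝ W]

/-- **Brouwer's fixed point theorem** for smooth maps with bounded range. -/
theorem exists_fixedPoint_of_contDiff_of_isBounded_range {g : W → W} (hg : ContDiff ℝ 1 g)
    (hb : Bornology.IsBounded (range g)) : ∃ x, g x = x := by
  -- The norm of `W` need not come from an inner product, so the map is transported to Euclidean
  -- space and scaled into the unit ball.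
  let φ := toEuclidean (E := W)
  have hb' : Bornology.IsBounded (φ '' range g) := φ.lipschitz.isBounded_image hb
  obtain ⟨R, hR0, hR⟩ := hb'.exists_pos_norm_lt
  obtain ⟨y, hy⟩ := exists_fixedPoint_of_contDiff_of_norm_lt_one
    (g := fun y => R⁻¹ • φ (g (φ.symm (R • y))))
    ((φ.contDiff.comp (hg.comp (φ.symm.contDiff.comp (contDiff_id.const_smul R)))).const_smul R⁻¹)
    (fun y => by
      rw [norm_smul, Real.norm_of_nonneg (by positivity), inv_mul_lt_one₀ hR0]
      exact hR _ ⟨_, mem_range_self _, rfl⟩)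
  refine ⟨φ.symm (R • y), φ.injective ?_⟩
  rw [φ.apply_symm_apply]
  conv_rhs => rw [← hy]
  rw [smul_inv_smul₀ hR0.ne']

/-- The **Fan–Browder fixed point theorem** in finite dimension: a correspondence of a compact
convex set with nonempty convex values and open fibres has a fixed point. -/
theorem exists_mem_of_convex_of_eventually_mem {K : Set W} (hK : IsClosed K)
    (hKb : Bornology.IsBounded K) (hKc : Convex ℝ K) (hKn : K.Nonempty) {T : W → Set W}
    (hTK : ∀ x ∈ K, T x ⊆ K) (hTc : ∀ x ∈ K, Convex ℝ (T x))
    (hT : ∀ x ∈ K, ∃ v ∈ K, ∀ᶠ y in 𝓝[K] x, v ∈ T y) : ∃ x ∈ K, x ∈ T x := by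
  classical
  obtain ⟨v₀, hv₀⟩ := hKn
  -- A global C¹ selection, glued from locally constant ones. Setting the value to `K` off `K` keeps
  -- the range of `g` in `K`, which places the fixed point in `K`.
  obtain ⟨g, hg⟩ := exists_contMDiffMap_forall_mem_convex_of_local_const 𝓘(ℝ, W) (n := 1)
    (t := fun x => if x ∈ K then T x else K)
    (fun x => by
      by_cases hx : x ∈ K
      · simpa [hx] using hTc x hx
      · simpa [hx] using hKc)
    (fun x => by
      by_cases hx : x ∈ K
      · obtain ⟨v, hvK, hv⟩ := hT x hx
        refine ⟨v, ?_⟩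
        filter_upwards [eventually_nhdsWithin_iff.1 hv] with y hy
        by_cases hyK : y ∈ K
        · simpa [hyK] using hy hyK
        · simpa [hyK] using hvK
      · refine ⟨v₀, ?_⟩
        filter_upwards [hK.isOpen_compl.mem_nhds hx] with y hy
        have hy' : y ∉ K := hy
        simpa [hy'] using hv₀)
  have hgK : ∀ x, g x ∈ K := fun x => by
    have := hg x
    by_cases hx : x ∈ K
    · rw [if_pos hx] at this
      exact hTK x hx this
    · rwa [if_neg hx] at this
  obtain ⟨x, hx⟩ := exists_fixedPoint_of_contDiff_of_isBounded_range (g := g)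
    g.contMDiff.contDiff (hKb.subset (range_subset_iff.2 hgK))
  have hxK : x ∈ K := hx ▸ hgK x
  have := hg x
  rw [if_pos hxK, hx] at this
  exact ⟨x, hxK, this⟩

end FanBrowder

/-! ### Equilibria of games whose costs depend on the mean strategy. -/

namespace EIRM

open Set Filter Topology

section MeanGame

variable {E A : Type*} [Fintype E] [DecidableEq E] [Nonempty E]
  [NormedAddCommGroup A] [NormedSpace ℝ A]

/-- The average of the weights of all environments. -/
noncomputable def meanWeight (w : E → A) : A := (1 / (Fintype.card E : ℝ)) • ∑ q, w q

omit [DecidableEq E] in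
theorem meanWeight_mem {H : Set A} (hH : Convex ℝ H) {w : E → A} (hw : ∀ q, w q ∈ H) :
    meanWeight w ∈ H := by
  rw [meanWeight, Finset.smul_sum]
  refine hH.sum_mem (fun _ _ => by positivity) ?_ fun q _ => hw q
  simp

omit [Nonempty E] in
theorem meanWeight_update (w : E → A) (e : E) (k : A) :
    meanWeight (Function.update w e k)
      = meanWeight w + (1 / (Fintype.card E : ℝ)) • (k - w e) := by
  rw [meanWeight, meanWeight, ← smul_add, Finset.sum_update_of_mem (Finset.mem_univ e),
    ← Finset.add_sum_erase _ w (Finset.mem_univ e), Finset.sdiff_singleton_eq_erase]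
  congr 1
  abel

/-- The mean is a homeomorphic function of one player's strategy, and maps the open set `interior H`
into `H`. An interior deviation thus reaches a mean where convex costs are continuous. -/
theorem meanWeight_update_mem_interior {H : Set A} (hH : Convex ℝ H) {w : E → A}
    (hw : ∀ q, w q ∈ H) (e : E) {k : A} (hk : k ∈ interior H) :
    meanWeight (Function.update w e k) ∈ interior H := by
  have hm : (1 / (Fintype.card E : ℝ)) ≠ 0 := by simp
  let φ : A ≃ₜ A := (Homeomorph.smulOfNeZero _ hm).trans
    (Homeomorph.addLeft (meanWeight w - (1 / (Fintype.card E : ℝ)) • w e))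
  have hφ : ∀ x, φ x = meanWeight (Function.update w e x) := by
    intro x
    rw [meanWeight_update, smul_sub]
    simp only [φ, Homeomorph.trans_apply, Homeomorph.coe_addLeft, Homeomorph.smulOfNeZero_apply]
    abel
  refine interior_maximal ?_ (φ.isOpenMap _ isOpen_interior) ⟨k, hk, hφ k⟩
  rintro _ ⟨x, hx, rfl⟩
  rw [hφ]
  refine meanWeight_mem hH fun q => ?_
  rcases eq_or_ne q e with rfl | hq
  · simpa using interior_subset hx
  · simpa [hq] using hw q

omit [DecidableEq E] [Nonempty E] in
theorem continuous_meanWeight : Continuous (meanWeight : (E → A) → A) := by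
  unfold meanWeight
  fun_prop

variable {H : Set A} {f : E → A → ℝ}

/-- The total cost of the unilateral deviations from `w` to `v` is convex in `v`. -/
theorem convexOn_sum_update (hf : ∀ e, ConvexOn ℝ H (f e)) {w : E → A} (hw : ∀ q, w q ∈ H) :
    ConvexOn ℝ (univ.pi fun _ : E => H)
      fun v => ∑ e, f e (meanWeight (Function.update w e (v e))) := by
  have hH : Convex ℝ H := (hf (Classical.arbitrary E)).1
  have hmem : ∀ v ∈ univ.pi fun _ : E => H, ∀ e, meanWeight (Function.update w e (v e)) ∈ H := by
    intro v hv e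
    refine meanWeight_mem hH fun q => ?_
    rcases eq_or_ne q e with rfl | hq
    · simpa using hv q (mem_univ q)
    · simpa [hq] using hw q
  refine ⟨convex_pi fun _ _ => hH, fun v hv u hu a b ha hb hab => ?_⟩
  rw [Finset.smul_sum, Finset.smul_sum, ← Finset.sum_add_distrib]
  refine Finset.sum_le_sum fun e _ => ?_
  have : meanWeight (Function.update w e ((a • v + b • u) e))
      = a • meanWeight (Function.update w e (v e)) + b • meanWeight (Function.update w e (u e)) := by
    simp only [meanWeight_update, Pi.add_apply, Pi.smul_apply]
    have : b = 1 - a := by linarith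
    subst this
    module
  rw [this]
  exact (hf e).2 (hmem v hv e) (hmem u hu e) ha hb hab

/-- A game with convex, lower semicontinuous costs that depend on the average of the strategies
only has a pure Nash equilibrium. The costs may be discontinuous on the boundary. -/
theorem exists_nash_meanWeight [FiniteDimensional ℝ A] (hHc : IsClosed H)
    (hHb : Bornology.IsBounded H) (hHi : (interior H).Nonempty)
    (hf : ∀ e, ConvexOn ℝ H (f e)) (hlsc : ∀ e, LowerSemicontinuousOn (f e) H) :
    ∃ w : E → A, (∀ e, w e ∈ H) ∧
      ∀ e, ∀ k ∈ H, f e (meanWeight w) ≤ f e (meanWeight (Function.update w e k)) := by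
  by_contra! hno
  have hH : Convex ℝ H := (hf (Classical.arbitrary E)).1
  obtain ⟨w₀, hw₀⟩ := hHi
  set K : Set (E → A) := univ.pi fun _ => H with hK
  have hmemK : ∀ w, w ∈ K ↔ ∀ e, w e ∈ H := by simp [hK]
  set G : (E → A) → (E → A) → ℝ :=
    fun w v => ∑ e, f e (meanWeight (Function.update w e (v e))) with hG
  set F : (E → A) → ℝ := fun w => ∑ e, f e (meanWeight w) with hF
  have hGconv : ∀ w ∈ K, ConvexOn ℝ K (G w) := fun w hw =>
    convexOn_sum_update hf ((hmemK w).1 hw)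
  have hw₀K : (fun _ => w₀) ∈ K := (hmemK _).2 fun _ => interior_subset hw₀
  -- A fixed point of `w ↦ {v ∈ K | G w v < F w}` contradicts `G w w = F w`.
  suffices hT : ∀ w ∈ K, ∃ v ∈ K, ∀ᶠ y in 𝓝[K] w, v ∈ {v ∈ K | G y v < F y} by
    obtain ⟨w, -, hwT⟩ := exists_mem_of_convex_of_eventually_mem (K := K)
      (isClosed_set_pi fun _ _ => hHc) (Bornology.IsBounded.pi fun _ => hHb)
      (convex_pi fun _ _ => hH) ⟨_, hw₀K⟩ (T := fun w => {v ∈ K | G w v < F w})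
      (fun w _ => sep_subset _ _) (fun w hw => (hGconv w hw).convex_lt (F w)) hT
    have : G w w = F w := by simp [hG, hF]
    exact absurd hwT.2 this.not_lt
  intro w hw
  have hw' := (hmemK w).1 hw
  obtain ⟨e, k, hk, hlt⟩ := hno w hw'
  have hvK : Function.update w e k ∈ K := by
    refine (hmemK _).2 fun q => ?_
    rcases eq_or_ne q e with rfl | hq
    · simpa using hk
    · simpa [hq] using hw' q
  have hGv : G w (Function.update w e k) < F w := by
    refine Finset.sum_lt_sum (fun q _ => ?_) ⟨e, Finset.mem_univ e, by simpa using hlt⟩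
    rcases eq_or_ne q e with rfl | hq
    · simpa using hlt.le
    · simp [hq]
  -- The profitable deviation may lead to a boundary mean, where upper semicontinuity can fail. A
  -- small move towards the interior point `w₀` keeps the strict inequality.
  obtain ⟨t, ht0, ht1, htlt⟩ : ∃ t : ℝ, 0 < t ∧ t < 1 ∧
      (1 - t) * G w (Function.update w e k) + t * G w (fun _ => w₀) < F w := by
    have hcont : Continuous fun t : ℝ =>
        (1 - t) * G w (Function.update w e k) + t * G w (fun _ => w₀) := by fun_prop
    have hev : ∀ᶠ t in 𝓝[>] (0 : ℝ),
        (1 - t) * G w (Function.update w e k) + t * G w (fun _ => w₀) < F w :=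
      (hcont.continuousAt.eventually_lt continuousAt_const (by simpa using hGv)).filter_mono
        nhdsWithin_le_nhds
    obtain ⟨t, h1, h2⟩ := (hev.and (Ioo_mem_nhdsGT one_pos)).exists
    exact ⟨t, h2.1, h2.2, h1⟩
  set v : E → A := (1 - t) • Function.update w e k + t • fun _ => w₀ with hv
  have hvi : ∀ q, v q ∈ interior H := fun q =>
    hH.combo_self_interior_mem_interior ((hmemK _).1 hvK q) hw₀ (by linarith) ht0 (by linarith)
  have hGvt : G w v < F w :=
    ((hGconv w hw).2 hvK hw₀K (by linarith) ht0.le (by linarith)).trans_lt htlt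
  have hvK' : v ∈ K := (hmemK v).2 fun q => interior_subset (hvi q)
  refine ⟨v, hvK', ?_⟩
  obtain ⟨c, hc1, hc2⟩ := exists_between hGvt
  have hGcont : ContinuousAt (fun y => G y v) w := by
    refine tendsto_finsetSum _ fun q _ => ?_
    have h1 : ContinuousAt (f q) (meanWeight (Function.update w q (v q))) :=
      (hf q).continuousOn_interior.continuousAt
        (isOpen_interior.mem_nhds (meanWeight_update_mem_interior hH hw' q (hvi q)))
    have h2 : Continuous fun y : E → A => meanWeight (Function.update y q (v q)) :=
      continuous_meanWeight.comp (continuous_id.update q continuous_const)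
    exact ContinuousAt.comp (f := fun y : E → A => meanWeight (Function.update y q (v q)))
      h1 h2.continuousAt
  have hFlsc : LowerSemicontinuousWithinAt F K w := by
    refine lowerSemicontinuousWithinAt_sum fun q _ => ?_
    intro b hb
    have htend : Tendsto meanWeight (𝓝[K] w) (𝓝[H] (meanWeight w)) :=
      tendsto_nhdsWithin_of_tendsto_nhds_of_eventually_within _
        (continuous_meanWeight.continuousAt.mono_left nhdsWithin_le_nhds)
        (eventually_mem_nhdsWithin.mono fun y hy => meanWeight_mem hH ((hmemK y).1 hy))
    exact htend.eventually (hlsc q _ (meanWeight_mem hH hw') b hb)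
  filter_upwards [hFlsc c hc2,
    (hGcont.eventually_lt continuousAt_const hc1).filter_mono nhdsWithin_le_nhds] with y hy1 hy2
  exact ⟨hvK', hy2.trans hy1⟩

end MeanGame

end EIRM

/-! ### Convexity, lower semicontinuity and extrapolation of expected losses. -/

namespace EIRM

open Set Filter Topology

section ExpectedLoss

variable {Ω A : Type*} [MeasurableSpace Ω] {μ : Measure Ω} [NormedAddCommGroup A]
  [NormedSpace ℝ A] {H : Set A} {L : A → Ω → ℝ}

theorem expect_mono {g h : Ω → ℝ} (hgh : ∀ p, g p ≤ h p) : expect μ g ≤ expect μ h := by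
  refine EReal.sub_le_sub ?_ ?_
  · exact EReal.coe_ennreal_le_coe_ennreal_iff.2
      (lintegral_mono fun p => ENNReal.ofReal_le_ofReal (hgh p))
  · exact EReal.coe_ennreal_le_coe_ennreal_iff.2
      (lintegral_mono fun p => ENNReal.ofReal_le_ofReal (neg_le_neg (hgh p)))

theorem convexOn_integral (hH : Convex ℝ H) (hL : ∀ p, ConvexOn ℝ univ fun w => L w p)
    (hint : ∀ w ∈ H, Integrable (L w) μ) : ConvexOn ℝ H fun w => ∫ p, L w p ∂μ := by
  refine ⟨hH, fun x hx y hy a b ha hb hab => ?_⟩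
  simp only [smul_eq_mul]
  rw [← integral_const_mul, ← integral_const_mul,
    ← integral_add ((hint x hx).const_mul a) ((hint y hy).const_mul b)]
  exact integral_mono (hint _ (hH hx hy ha hb hab))
    (((hint x hx).const_mul a).add ((hint y hy).const_mul b))
    fun p => (hL p).2 (mem_univ x) (mem_univ y) ha hb hab

/-- Convex losses that are integrable over a bounded set with nonempty interior have a common
integrable minorant there. -/
theorem exists_integrable_le [FiniteDimensional ℝ A] (hHb : Bornology.IsBounded H)
    (hHi : (interior H).Nonempty) (hL : ∀ p, ConvexOn ℝ univ fun w => L w p)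
    (hint : ∀ w ∈ H, Integrable (L w) μ) :
    ∃ h : Ω → ℝ, Integrable h μ ∧ ∀ w ∈ H, ∀ p, h p ≤ L w p := by
  obtain ⟨w₀, hw₀⟩ := hHi
  -- A simplex around `w₀` with vertices in `H`: on it the loss is bounded above by its values at
  -- finitely many vertices, which are integrable.
  obtain ⟨b, hb, hbH⟩ :=
    exists_mem_interior_convexHull_affineBasis (mem_interior_iff_mem_nhds.1 hw₀)
  obtain ⟨ε, hε, hball⟩ := Metric.mem_nhds_iff.1 (mem_interior_iff_mem_nhds.1 hb)
  obtain ⟨R, hR0, hR⟩ := (hHb.sub Bornology.isBounded_singleton (t := {w₀})).exists_pos_norm_lt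
  set δ : ℝ := ε / R with hδ
  have hδ0 : 0 < δ := div_pos hε hR0
  have hbi : ∀ i, Integrable (L (b i)) μ := fun i =>
    hint _ (hbH (subset_convexHull ℝ _ (mem_range_self i)))
  refine ⟨fun p => δ⁻¹ * ((1 + δ) * L w₀ p - ∑ i, |L (b i) p|), ?_, fun w hw p => ?_⟩
  · exact (((hint w₀ (interior_subset hw₀)).const_mul _).sub
      (integrable_finsetSum _ fun i _ => (hbi i).abs)).const_mul _
  -- Reflecting `w` through `w₀` and shrinking by `δ` lands in the simplex. As `w₀` lies between `w`
  -- and `w'`, the upper bound at `w'` becomes a lower bound at `w`.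
  · set w' := w₀ - δ • (w - w₀) with hw'
    have hw'mem : w' ∈ convexHull ℝ (range b) := by
      apply hball
      rw [mem_ball_iff_norm, hw', sub_sub_cancel_left, norm_neg, norm_smul,
        Real.norm_of_nonneg hδ0.le]
      calc δ * ‖w - w₀‖ < δ * R :=
            mul_lt_mul_of_pos_left (hR _ (sub_mem_sub hw rfl)) hδ0
        _ = ε := div_mul_cancel₀ _ hR0.ne'
    obtain ⟨_, ⟨i, rfl⟩, hi⟩ := (hL p).exists_ge_of_mem_convexHull (subset_univ _) hw'mem
    have h1 : L w' p ≤ ∑ i, |L (b i) p| :=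
      hi.trans ((le_abs_self _).trans (Finset.single_le_sum
        (f := fun i => |L (b i) p|) (fun _ _ => abs_nonneg _) (Finset.mem_univ i)))
    have hpos : 0 < 1 + δ := by linarith
    have h2 := (hL p).2 (mem_univ w') (mem_univ w) (inv_nonneg.2 hpos.le)
      (mul_nonneg (inv_nonneg.2 hpos.le) hδ0.le)
      (show (1 + δ)⁻¹ + (1 + δ)⁻¹ * δ = 1 by field_simp)
    have h3 : (1 + δ)⁻¹ • w' + ((1 + δ)⁻¹ * δ) • w = w₀ := by
      have : w' + δ • w = (1 + δ) • w₀ := by rw [hw']; module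
      rw [mul_smul, ← smul_add, this, inv_smul_smul₀ hpos.ne']
    simp only [h3, smul_eq_mul] at h2
    have h4 : (1 + δ) * L w₀ p ≤ L w' p + δ * L w p := by
      calc (1 + δ) * L w₀ p
          ≤ (1 + δ) * ((1 + δ)⁻¹ * L w' p + (1 + δ)⁻¹ * δ * L w p) := by gcongr
        _ = L w' p + δ * L w p := by field_simp
    rw [inv_mul_le_iff₀ hδ0]
    linarith

omit [NormedSpace ℝ A] in
-- Fatou's lemma for `L - h ≥ 0` along a sequence violating semicontinuity; the minorant `h`
-- supplies the required nonnegativity.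
theorem lowerSemicontinuousOn_integral {h : Ω → ℝ} (hLc : ∀ p, Continuous fun w => L w p)
    (hint : ∀ w ∈ H, Integrable (L w) μ) (hh : Integrable h μ)
    (hle : ∀ w ∈ H, ∀ p, h p ≤ L w p) :
    LowerSemicontinuousOn (fun w => ∫ p, L w p ∂μ) H := by
  intro w hw c hc
  by_contra hcon
  obtain ⟨u, hu, huc⟩ := exists_seq_forall_of_frequently
    ((not_eventually.1 hcon).and_eventually eventually_mem_nhdsWithin)
  have hlim : ∀ p, Tendsto (fun n => ENNReal.ofReal (L (u n) p - h p)) atTop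
      (𝓝 (ENNReal.ofReal (L w p - h p))) := fun p =>
    ENNReal.tendsto_ofReal
      ((((hLc p).tendsto w).comp (hu.mono_right nhdsWithin_le_nhds)).sub_const _)
  have hval : ∀ v ∈ H, ∫⁻ p, ENNReal.ofReal (L v p - h p) ∂μ
      = ENNReal.ofReal (∫ p, L v p ∂μ - ∫ p, h p ∂μ) := fun v hv => by
    rw [← integral_sub (hint v hv) hh]
    exact (ofReal_integral_eq_lintegral_ofReal ((hint v hv).sub hh)
      (ae_of_all _ fun p => sub_nonneg.2 (hle v hv p))).symm
  have hfatou := lintegral_liminf_le' (μ := μ) (u := atTop)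
    (f := fun n p => ENNReal.ofReal (L (u n) p - h p))
    fun n => ((hint _ (huc n).2).sub hh).aemeasurable.ennreal_ofReal
  simp only [fun p => (hlim p).liminf_eq, hval w hw] at hfatou
  have hub : liminf (fun n => ∫⁻ p, ENNReal.ofReal (L (u n) p - h p) ∂μ) atTop
      ≤ ENNReal.ofReal (c - ∫ p, h p ∂μ) := by
    refine (liminf_le_liminf (Eventually.of_forall fun n => ?_)).trans_eq
      (liminf_const (ENNReal.ofReal (c - ∫ p, h p ∂μ)))
    rw [hval _ (huc n).2]
    exact ENNReal.ofReal_le_ofReal (sub_le_sub_right (not_lt.1 (huc n).1) _)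
  have hnonneg : ∀ v ∈ H, 0 ≤ ∫ p, L v p ∂μ - ∫ p, h p ∂μ := fun v hv =>
    sub_nonneg.2 (integral_mono hh (hint v hv) (hle v hv))
  have hc0 : 0 ≤ c - ∫ p, h p ∂μ :=
    (hnonneg _ (huc 0).2).trans (sub_le_sub_right (not_lt.1 (huc 0).1) _)
  have := (ENNReal.ofReal_le_ofReal_iff hc0).1 (hfatou.trans hub)
  linarith

/-- A point whose expected loss does not exceed the expected loss at some point of the open segment
towards `u` has no larger expected loss than `u`, where the latter may be infinite. -/
theorem expect_le_of_integral_le_segment {a u : A} {t : ℝ}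
    (hL : ∀ p, ConvexOn ℝ univ fun w => L w p) (ht0 : 0 < t) (ht1 : t ≤ 1)
    (ha : Integrable (L a) μ) (hat : Integrable (L (a + t • (u - a))) μ)
    (hle : ∫ p, L a p ∂μ ≤ ∫ p, L (a + t • (u - a)) p ∂μ) :
    expect μ (L a) ≤ expect μ (L u) := by
  -- The affine extrapolation to `u` of the loss at `a` and at the segment point. It lies below `L
  -- u` by convexity and is integrable, so no integrability of `L u` is needed.
  set h : Ω → ℝ := fun p => L a p + t⁻¹ * (L (a + t • (u - a)) p - L a p) with hh
  have hd : Integrable (fun p => t⁻¹ * (L (a + t • (u - a)) p - L a p)) μ :=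
    (hat.sub ha).const_mul _
  have hhint : Integrable h μ := ha.add hd
  have hhu : ∀ p, h p ≤ L u p := fun p => by
    have h1 := (hL p).2 (mem_univ a) (mem_univ u) (sub_nonneg.2 ht1) ht0.le (by ring)
    have h2 : (1 - t) • a + t • u = a + t • (u - a) := by module
    simp only [h2, smul_eq_mul] at h1
    have h3 : t⁻¹ * (L (a + t • (u - a)) p - L a p) ≤ L u p - L a p := by
      rw [inv_mul_le_iff₀ ht0]
      linarith
    simp only [hh]
    linarith
  refine le_trans ?_ (expect_mono hhu)
  rw [expect_eq_integral ha, expect_eq_integral hhint, EReal.coe_le_coe_iff, hh,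
    integral_add ha hd, integral_const_mul, integral_sub hat ha]
  have : 0 ≤ t⁻¹ * (∫ p, L (a + t • (u - a)) p ∂μ - ∫ p, L a p ∂μ) :=
    mul_nonneg (by positivity) (sub_nonneg.2 hle)
  linarith

end ExpectedLoss

/-! ### Translation between classifiers and weight vectors. -/

section LinearClassifiers

variable {E : Type*} {d : ℕ} {Z : Set (EuclideanSpace ℝ (Fin d))}

theorem ensemble_linearClassifier [Fintype E] (w : E → EuclideanSpace ℝ (Fin d)) :
    ensemble (fun e => linearClassifier Z (w e)) = linearClassifier Z (meanWeight w) := by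
  funext z
  simp only [ensemble, linearClassifier, meanWeight, inner_smul_left, sum_inner]
  simp

theorem update_linearClassifier [DecidableEq E] (w : E → EuclideanSpace ℝ (Fin d)) (e : E)
    (k : EuclideanSpace ℝ (Fin d)) :
    Function.update (fun q => linearClassifier Z (w q)) e (linearClassifier Z k)
      = fun q => linearClassifier Z (Function.update w e k q) := by
  funext q
  exact (Function.apply_update (fun _ v => linearClassifier Z v) w e k q).symm

variable {X Y : Type*} [MeasurableSpace X] [MeasurableSpace Y] {P : E → Measure (X × Y)}
  {loss : ℝ → Y → ℝ} {HΦ : Set (X → Z)} {Hw : Set (EuclideanSpace ℝ (Fin d))}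

theorem risk_linearClassifier {Φ : X → Z} {v : EuclideanSpace ℝ (Fin d)} {e : E}
    (hint : Integrable (fun p : X × Y => loss (linearClassifier Z v (Φ p.1)) p.2) (P e)) :
    risk P loss e (linearClassifier Z v ∘ Φ)
      = ((∫ p, loss (linearClassifier Z v (Φ p.1)) p.2 ∂(P e) : ℝ) : EReal) :=
  expect_eq_integral hint

/-- Equilibrium in terms of the risks, as real numbers, of the averages of the weights. -/
theorem mem_pureNE_linearClassifier_iff [Fintype E] [DecidableEq E] [Nonempty E]
    (hHw : Convex ℝ Hw) {Φ : X → Z} (hΦ : Φ ∈ HΦ)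
    (hint : ∀ w ∈ Hw, ∀ e,
      Integrable (fun p : X × Y => loss (linearClassifier Z w (Φ p.1)) p.2) (P e))
    {w : E → EuclideanSpace ℝ (Fin d)} (hw : ∀ e, w e ∈ Hw) :
    (Φ, fun e => linearClassifier Z (w e)) ∈ pureNE P loss HΦ (linearClassifier Z '' Hw) ↔
      ∀ e, ∀ k ∈ Hw, ∫ p, loss (linearClassifier Z (meanWeight w) (Φ p.1)) p.2 ∂(P e) ≤
        ∫ p, loss (linearClassifier Z (meanWeight (Function.update w e k)) (Φ p.1)) p.2 ∂(P e) := by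
  have hupd : ∀ e, ∀ k ∈ Hw, meanWeight (Function.update w e k) ∈ Hw := by
    intro e k hk
    refine meanWeight_mem hHw fun q => ?_
    rcases eq_or_ne q e with rfl | hq
    · simpa using hk
    · simpa [hq] using hw q
  simp only [pureNE, IsPureNash, mem_ofPred_eq, hΦ, true_and, mem_image_of_mem _ (hw _),
    implies_true, forall_mem_image, utility, update_linearClassifier, ensemble_linearClassifier,
    EReal.neg_le_neg_iff]
  refine forall_congr' fun e => forall₂_congr fun k hk => ?_
  rw [risk_linearClassifier (hint _ (meanWeight_mem hHw hw) e),
    risk_linearClassifier (hint _ (hupd e k hk) e), EReal.coe_le_coe_iff]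

end LinearClassifiers

end EIRM

/-! ### The two claims. -/

theorem theorem3 {E : Type*} [Fintype E] [DecidableEq E] [Nonempty E] {n d : ℕ}
    -- feature space, label space, and codomain of the representations
    (X : Set (EuclideanSpace ℝ (Fin n))) (Y : Set ℝ) (Z : Set (EuclideanSpace ℝ (Fin d)))
    -- the joint law of feature and label in each training environment
    (P : E → Measure (X × Y)) (hP : ∀ e, IsProbabilityMeasure (P e))
    -- the loss and the class of representations
    (loss : ℝ → Y → ℝ) (hloss_meas : Measurable (fun p : ℝ × Y => loss p.1 p.2))
    (HΦ : Set (X → Z)) (hHΦ_meas : ∀ Φ ∈ HΦ, Measurable Φ)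
    -- the set of weight vectors
    (Hw : Set (EuclideanSpace ℝ (Fin d)))
    (hHw_closed : IsClosed Hw) (hHw_bdd : Bornology.IsBounded Hw) (hHw_convex : Convex ℝ Hw)
    (hHw_int : (interior Hw).Nonempty)
    -- the loss is convex and continuous in the weights
    (hloss_convex : ∀ (z : Z) (y : Y),
      ConvexOn ℝ Set.univ (fun w => loss (EIRM.linearClassifier Z w z) y))
    (hloss_cont : ∀ (z : Z) (y : Y), Continuous (fun w => loss (EIRM.linearClassifier Z w z) y))
    -- the risks that occur in the game are finite
    (hfinite : ∀ Φ ∈ HΦ, ∀ w ∈ Hw, ∀ e,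
      Integrable (fun p : X × Y => loss (EIRM.linearClassifier Z w (Φ p.1)) p.2) (P e)) :
    -- every representation admits a pure Nash equilibrium
    (∀ Φ ∈ HΦ, ∃ w : E → EuclideanSpace ℝ (Fin d), (∀ e, w e ∈ Hw) ∧
      (Φ, fun e => EIRM.linearClassifier Z (w e)) ∈
        EIRM.pureNE P loss HΦ (EIRM.linearClassifier Z '' Hw)) ∧
    -- equilibria with interior weights give invariant predictors among all linear models
    (∀ (Φ : X → Z) (w : E → EuclideanSpace ℝ (Fin d)),
      (Φ, fun e => EIRM.linearClassifier Z (w e)) ∈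
        EIRM.pureNE P loss HΦ (EIRM.linearClassifier Z '' Hw) →
      (∀ e, w e ∈ interior Hw) →
      (Φ, EIRM.ensemble (fun e => EIRM.linearClassifier Z (w e))) ∈
        EIRM.invariantPairs P loss HΦ (Set.range (EIRM.linearClassifier Z))) := by
  constructor
  · intro Φ hΦ
    obtain ⟨w, hw, hne⟩ := EIRM.exists_nash_meanWeight (E := E) hHw_closed hHw_bdd hHw_int
      (f := fun e v => ∫ p, loss (EIRM.linearClassifier Z v (Φ p.1)) p.2 ∂(P e))
      (fun e => EIRM.convexOn_integral hHw_convex (fun p => hloss_convex (Φ p.1) p.2)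
        fun v hv => hfinite Φ hΦ v hv e)
      (fun e => by
        obtain ⟨h, hh, hle⟩ := EIRM.exists_integrable_le (μ := P e) hHw_bdd hHw_int
          (L := fun v p => loss (EIRM.linearClassifier Z v (Φ p.1)) p.2)
          (fun p => hloss_convex (Φ p.1) p.2) fun v hv => hfinite Φ hΦ v hv e
        exact EIRM.lowerSemicontinuousOn_integral (fun p => hloss_cont (Φ p.1) p.2)
          (fun v hv => hfinite Φ hΦ v hv e) hh hle)
    exact ⟨w, hw, (EIRM.mem_pureNE_linearClassifier_iff hHw_convex hΦ (hfinite Φ hΦ) hw).2 hne⟩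
  · intro Φ w hne hwi
    have hΦ : Φ ∈ HΦ := hne.1
    have hw : ∀ e, w e ∈ Hw := fun e => interior_subset (hwi e)
    rw [EIRM.mem_pureNE_linearClassifier_iff hHw_convex hΦ (hfinite Φ hΦ) hw] at hne
    rw [EIRM.ensemble_linearClassifier]
    refine ⟨hΦ, Set.mem_range_self _, ?_⟩
    rintro e _ ⟨u, rfl⟩
    set a := EIRM.meanWeight w with ha
    set m : ℝ := (Fintype.card E : ℝ) with hm
    have hm1 : 1 ≤ m := by
      rw [hm]
      exact_mod_cast Fintype.card_pos
    -- Environment `e` moves its own weight in the direction `u - a`, which is admissible for small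
    -- `s` because `w e` is interior. The average then moves from `a` towards `u` by the fraction `s
    -- / m`.
    obtain ⟨s, hsH, hs0, hs1⟩ : ∃ s : ℝ, w e + s • (u - a) ∈ Hw ∧ 0 < s ∧ s < 1 := by
      have hcont : Continuous fun s : ℝ => w e + s • (u - a) := by fun_prop
      have h0 : ∀ᶠ s in nhds (0 : ℝ), w e + s • (u - a) ∈ Hw :=
        hcont.continuousAt.eventually_mem (by simpa using mem_interior_iff_mem_nhds.1 (hwi e))
      obtain ⟨s, h1, h2⟩ := ((h0.filter_mono nhdsWithin_le_nhds).and
        (Ioo_mem_nhdsGT (one_pos : (0 : ℝ) < 1))).exists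
      exact ⟨s, h1, h2.1, h2.2⟩
    have hmean : EIRM.meanWeight (Function.update w e (w e + s • (u - a)))
        = a + (1 / m * s) • (u - a) := by
      rw [EIRM.meanWeight_update, add_sub_cancel_left, smul_smul]
    -- Integrability is assumed only on `Hw`, so the shifted average must lie there even if `u` does
    -- not.
    have hmem : a + (1 / m * s) • (u - a) ∈ Hw := by
      rw [← hmean]
      refine EIRM.meanWeight_mem hHw_convex fun q => ?_
      rcases eq_or_ne q e with rfl | hq
      · simpa using hsH
      · simpa [hq] using hw q
    have hle := hne e _ hsH
    rw [hmean] at hle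
    refine EIRM.expect_le_of_integral_le_segment
      (L := fun v (p : X × Y) => loss (EIRM.linearClassifier Z v (Φ p.1)) p.2) (t := 1 / m * s)
      (fun p => hloss_convex (Φ p.1) p.2) (by positivity) ?_
      (hfinite Φ hΦ a (EIRM.meanWeight_mem hHw_convex hw) e) (hfinite Φ hΦ _ hmem e) hle
    exact mul_le_one₀ ((div_le_one (by positivity)).2 hm1) hs0.le hs1.le
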